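/- Rings are associative, but not necessarily commutative or unital. Let $R$ be a locally nilpotent ring, i.e. every finitely generated subring $S$ of $R$ is nilpotent ($S^n=0$ for some $n\ge 1$), and let $\delta$ be a derivation of $R$, i.e. an additive map $\delta:R\to R$ with $\delta(ab)=\delta(a)b+a\delta(b)$ for all $a,b\in R$. Let $R[X;\delta]$ be the differential polynomial ring: the ring of polynomials $\sum_{i=0}^n r_iX^i$ with coefficients $r_i\in R$, with multiplication determined by $Xr=rX+\delta(r)$ for $r\in R$. Then $R[X;\delta]$ has no homomorphic image containing a non-zero idempotent. Moreover (in the language of radical theory, equivalently), $R[X;\delta]$ is Behrens radical, that is, $R[X;\delta]$ cannot be mapped homomorphically onto a subdirectly irreducible ring whose heart (the intersection of all non-zero two-sided ideals, which is non-zero by subdirect irreducibility) contains a non-zero idempotent. -/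

import Mathlib

/-- A (finite-length) nilpotent ring: for some `n`, every product of `n + 1` elements
`x * a₁ * ⋯ * aₙ` is zero. Rings are associative, not necessarily commutative or unital. -/
def IsNilpotentRing (S : Type*) [NonUnitalRing S] : Prop :=
  ∃ n : ℕ, ∀ (x : S) (l : List S), l.length = n → l.foldl (fun a b => a * b) x = 0

/-- A ring is locally nilpotent if each of its finitely generated subrings is nilpotent. -/
def IsLocallyNilpotentRing (R : Type*) [NonUnitalRing R] : Prop :=
  ∀ s : Finset R, IsNilpotentRing (NonUnitalSubring.closure (s : Set R))

/-- A derivation of a ring: an additive map with the Leibniz rule. -/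
structure RingDerivation (R : Type*) [NonUnitalRing R] extends R →+ R where
  leibniz' : ∀ a b : R, toFun (a * b) = toFun a * b + a * toFun b

/-- The underlying additive group of the differential polynomial ring `R[X; δ]`: the
finitely supported sequences of coefficients, `f` standing for `∑ i, f i X ^ i`. -/
def DiffPoly.{u} {R : Type u} [NonUnitalRing R] (_δ : RingDerivation R) : Type u := ℕ →₀ R

namespace DiffPoly

variable {R : Type*} [NonUnitalRing R] (δ : RingDerivation R)

noncomputable instance : AddCommGroup (DiffPoly δ) := inferInstanceAs (AddCommGroup (ℕ →₀ R))

/-- The differential polynomial `r X ^ n`. -/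
noncomputable def monomial (n : ℕ) : R →+ DiffPoly δ := Finsupp.singleAddHom n

theorem hom_ext {M : Type*} [AddCommMonoid M] {f g : DiffPoly δ →+ M}
    (h : ∀ n r, f (monomial δ n r) = g (monomial δ n r)) : f = g :=
  Finsupp.addHom_ext h

/-- Left multiplication by an element `r` of `R` : `s X ^ n ↦ (r * s) X ^ n`. -/
noncomputable def coeffMul : R →+ AddMonoid.End (DiffPoly δ) where
  toFun r := (Finsupp.mapRange.addMonoidHom (AddMonoidHom.mulLeft r) : (ℕ →₀ R) →+ (ℕ →₀ R))
  map_zero' := hom_ext δ fun n s => by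
    refine (Finsupp.mapRange_single (f := AddMonoidHom.mulLeft (0 : R))
      (hf := map_zero _)).trans ?_
    simp
    rfl
  map_add' a b := AddMonoidHom.ext fun f => Finsupp.ext fun n => add_mul a b _

/-- Left multiplication by the indeterminate, as prescribed by `X r = r X + δ r` :
`s X ^ n ↦ s X ^ (n + 1) + (δ s) X ^ n`. -/
noncomputable def xMul : AddMonoid.End (DiffPoly δ) :=
  (Finsupp.mapDomain.addMonoidHom (fun n => n + 1) +
    Finsupp.mapRange.addMonoidHom δ.toAddMonoidHom : (ℕ →₀ R) →+ (ℕ →₀ R))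

/-- The multiplication `(∑ i, f i X ^ i) * g = ∑ i, f i (X ^ i g)`. -/
noncomputable def mulHom : DiffPoly δ →+ AddMonoid.End (DiffPoly δ) :=
  (Finsupp.liftAddHom fun i => (AddMonoidHom.mulRight (xMul δ ^ i)).comp (coeffMul δ) :
    (ℕ →₀ R) →+ AddMonoid.End (DiffPoly δ))

noncomputable instance : Mul (DiffPoly δ) := ⟨fun f g => mulHom δ f g⟩

theorem coeffMul_monomial (r s : R) (n : ℕ) :
    coeffMul δ r (monomial δ n s) = monomial δ n (r * s) :=
  Finsupp.mapRange_single (hf := map_zero (AddMonoidHom.mulLeft r))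

theorem xMul_monomial (s : R) (n : ℕ) :
    xMul δ (monomial δ n s) = monomial δ (n + 1) s + monomial δ n (δ.toFun s) :=
  congrArg₂ (fun a b : ℕ →₀ R => a + b) Finsupp.mapDomain_single
    (Finsupp.mapRange_single (hf := map_zero δ.toAddMonoidHom))

theorem monomial_mul (i : ℕ) (r : R) (g : DiffPoly δ) :
    monomial δ i r * g = coeffMul δ r ((xMul δ ^ i) g) :=
  DFunLike.congr_fun (Finsupp.liftAddHom_apply_single
    (fun i => (AddMonoidHom.mulRight (xMul δ ^ i)).comp (coeffMul δ)) i r) g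

theorem coeffMul_mul (r s : R) : coeffMul δ (r * s) = coeffMul δ r * coeffMul δ s :=
  hom_ext δ fun n t => by
    change coeffMul δ (r * s) (monomial δ n t) = coeffMul δ r (coeffMul δ s (monomial δ n t))
    rw [coeffMul_monomial, coeffMul_monomial, coeffMul_monomial, mul_assoc]

theorem xMul_coeffMul (s : R) :
    xMul δ * coeffMul δ s = coeffMul δ s * xMul δ + coeffMul δ (δ.toFun s) :=
  hom_ext δ fun n t => by
    change xMul δ (coeffMul δ s (monomial δ n t)) =
      coeffMul δ s (xMul δ (monomial δ n t)) + coeffMul δ (δ.toFun s) (monomial δ n t)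
    simp only [coeffMul_monomial, xMul_monomial, map_add, δ.leibniz']
    abel

theorem mulHom_coeffMul (r : R) (g : DiffPoly δ) :
    mulHom δ (coeffMul δ r g) = coeffMul δ r * mulHom δ g := by
  have h : (mulHom δ).comp (coeffMul δ r) =
      (AddMonoidHom.mulLeft (coeffMul δ r)).comp (mulHom δ) := hom_ext δ fun n s => by
    refine AddMonoidHom.ext fun u => ?_
    change mulHom δ (coeffMul δ r (monomial δ n s)) u = coeffMul δ r (monomial δ n s * u)
    rw [coeffMul_monomial, monomial_mul]
    refine (monomial_mul δ n (r * s) u).trans ?_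
    rw [coeffMul_mul]; rfl
  exact DFunLike.congr_fun h g

theorem mulHom_xMul (g : DiffPoly δ) : mulHom δ (xMul δ g) = xMul δ * mulHom δ g := by
  have h : (mulHom δ).comp (xMul δ) =
      (AddMonoidHom.mulLeft (xMul δ)).comp (mulHom δ) := hom_ext δ fun n s => by
    refine AddMonoidHom.ext fun u => ?_
    change mulHom δ (xMul δ (monomial δ n s)) u = xMul δ (monomial δ n s * u)
    rw [xMul_monomial, map_add, monomial_mul]
    change monomial δ (n + 1) s * u + monomial δ n (δ.toFun s) * u = _
    rw [monomial_mul, monomial_mul, pow_succ']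
    exact (DFunLike.congr_fun (xMul_coeffMul δ s) ((xMul δ ^ n) u)).symm
  exact DFunLike.congr_fun h g

theorem mulHom_xMul_pow (i : ℕ) (g : DiffPoly δ) :
    mulHom δ ((xMul δ ^ i) g) = xMul δ ^ i * mulHom δ g := by
  induction i with
  | zero => simp
  | succ i ih =>
    rw [pow_succ', mul_assoc, ← ih]
    exact mulHom_xMul δ ((xMul δ ^ i) g)

theorem mulHom_mul (f g : DiffPoly δ) : mulHom δ (f * g) = mulHom δ f * mulHom δ g := by
  have h : (mulHom δ).comp ((mulHom δ).flip g) =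
      (AddMonoidHom.mulRight (mulHom δ g)).comp (mulHom δ) := hom_ext δ fun n r => by
    refine AddMonoidHom.ext fun u => ?_
    change mulHom δ (monomial δ n r * g) u = monomial δ n r * (mulHom δ g u)
    rw [monomial_mul, monomial_mul, mulHom_coeffMul, mulHom_xMul_pow]; rfl
  exact DFunLike.congr_fun h f

/-- The differential polynomial ring `R[X; δ]`. -/
noncomputable instance : NonUnitalRing (DiffPoly δ) where
  left_distrib f g h := map_add (mulHom δ f) g h
  right_distrib f g h := DFunLike.congr_fun (map_add (mulHom δ) f g) h
  zero_mul f := DFunLike.congr_fun (map_zero (mulHom δ)) f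
  mul_zero f := map_zero (mulHom δ f)
  mul_assoc f g h := DFunLike.congr_fun (mulHom_mul δ f g) h

end DiffPoly

/-- The heart of a ring: the intersection of all its non-zero two-sided ideals. -/
def ringHeart (A : Type*) [NonUnitalRing A] : TwoSidedIdeal A :=
  sInf {I : TwoSidedIdeal A | I ≠ ⊥}

/-- A ring is subdirectly irreducible if its heart is non-zero. -/
def IsSubdirectlyIrreducibleRing (A : Type*) [NonUnitalRing A] : Prop :=
  ringHeart A ≠ ⊥

/-- Behrens radical rings, that is, the upper radical class determined by the subdirectly
irreducible rings whose heart contains a non-zero idempotent: the rings which cannot be mapped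
onto such a ring. (A homomorphic image of `S` is a quotient of `S` up to isomorphism, so it
suffices to let `A` range over the universe of `S`.) -/
def IsBehrensRadical.{u} (S : Type u) [NonUnitalRing S] : Prop :=
  ¬ ∃ (A : Type u) (_ : NonUnitalRing A) (φ : S →ₙ+* A), Function.Surjective φ ∧
    IsSubdirectlyIrreducibleRing A ∧ ∃ e ∈ ringHeart A, IsIdempotentElem e ∧ e ≠ 0

/-!
Let `φ` be a homomorphism from `R[X; δ]` with `φ f = e` idempotent, `f = ∑ i < n, aᵢ Xⁱ`. The
elements annihilated by `φ` after every left multiplication form a two-sided ideal `J` that is stable under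
left multiplication by `X`; it contains `f - f * f`, and it contains `f` only if `e = e * e = 0`.
So it suffices to show `f ∈ J`.

Put `gₖ = Xᵏ f`. With `d` the extension of `δ` to `R[X; δ]` acting on the coefficients, modulo `J`,
`gₖ ≡ Xᵏ (f * f) = ∑ j ≤ k, (k choose j) • dʲ f * gₖ₋ⱼ`. A term `dʲ f * gₘ` can be read in two ways:

* as `∑ i < n, δʲ(aᵢ) gᵢ₊ₘ`, which is a left `R`-combination of `g₀, …, g₂ₙ₋₁` if `m < n`;
* as an integral combination of `gₗ * (Xʲ⁻ˡ gₘ)` with `l ≤ j`, because `d` is the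
  commutator with `X`.

For `k < n` the first reading applies to all terms, so `gₖ ∈ ∑ P gₗ + J`, where `P` is the subring
generated by finitely many `δʲ(aᵢ)`. For `n ≤ k < 2n` each term has `m < n` or `j < n`, and
in the latter case the second reading leads back to `gₗ` with `l < n`. Hence all `gₖ` with
`k < 2n` lie in `∑ P gₗ S + J`, where `S` is `R[X; δ]` with a unit adjoined
(`map_xMul_pow_mem`). Iterating, they lie in `∑ Pᴺ gₗ S + J` for all `N`
(`coeffMul_xMul_pow_mem`), and `P` is nilpotent.
-/

namespace DiffPoly

variable {R : Type*} [NonUnitalRing R] (δ : RingDerivation R)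

theorem coeffMul_apply_mul (r : R) (g h : DiffPoly δ) :
    coeffMul δ r (g * h) = coeffMul δ r g * h :=
  (DFunLike.congr_fun (mulHom_coeffMul δ r g) h).symm

theorem xMul_mul (g h : DiffPoly δ) : xMul δ (g * h) = xMul δ g * h :=
  (DFunLike.congr_fun (mulHom_xMul δ g) h).symm

theorem mul_xMul_monomial (n : ℕ) (r : R) (h : DiffPoly δ) :
    monomial δ n r * xMul δ h = monomial δ (n + 1) r * h := by
  rw [monomial_mul, monomial_mul, pow_succ]
  rfl

/-- The differential polynomial `∑ i < n, a i X ^ i`. -/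
noncomputable def ofCoeffs (n : ℕ) (a : ℕ → R) : DiffPoly δ :=
  ∑ i ∈ Finset.range n, monomial δ i (a i)

theorem exists_eq_ofCoeffs (f : DiffPoly δ) : ∃ n a, 0 < n ∧ f = ofCoeffs δ n a := by
  let f' : ℕ →₀ R := f
  refine ⟨f'.support.sup id + 1, f', Nat.succ_pos _, ?_⟩
  have h : f' = ∑ i ∈ Finset.range (f'.support.sup id + 1), Finsupp.single i (f' i) := by
    conv_lhs => rw [← Finsupp.sum_single f']
    refine Finset.sum_subset (fun i hi => ?_) fun i _ hi => ?_
    · exact Finset.mem_range.2 (Nat.lt_succ_of_le (Finset.le_sup (f := id) hi))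
    · rw [Finsupp.notMem_support_iff.1 hi, Finsupp.single_zero]
  exact h

theorem ofCoeffs_mul (n : ℕ) (a : ℕ → R) (h : DiffPoly δ) :
    ofCoeffs δ n a * h = ∑ i ∈ Finset.range n, coeffMul δ (a i) ((xMul δ ^ i) h) := by
  simp only [ofCoeffs, Finset.sum_mul, monomial_mul]

/-- The ring has no unit, so `X` is not an element of it, but right multiplication by `X`
makes sense: it is `t ↦ t'`. -/
theorem exists_mul_xMul (t : DiffPoly δ) : ∃ t', ∀ h, t * xMul δ h = t' * h := by
  obtain ⟨n, a, -, rfl⟩ := exists_eq_ofCoeffs δ t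
  refine ⟨∑ i ∈ Finset.range n, monomial δ (i + 1) (a i), fun h => ?_⟩
  simp only [ofCoeffs, Finset.sum_mul, mul_xMul_monomial]

/-- Applying `δ` to the coefficients is the commutator with `X`. -/
theorem xMul_ofCoeffs_mul (n : ℕ) (a : ℕ → R) (h : DiffPoly δ) :
    xMul δ (ofCoeffs δ n a * h) =
      ofCoeffs δ n (fun i => δ.toFun (a i)) * h + ofCoeffs δ n a * xMul δ h := by
  simp only [ofCoeffs_mul, map_sum, ← Finset.sum_add_distrib]
  refine Finset.sum_congr rfl fun i _ => ?_
  have h1 := DFunLike.congr_fun (xMul_coeffMul δ (a i)) ((xMul δ ^ i) h)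
  have h2 : xMul δ ((xMul δ ^ i) h) = (xMul δ ^ i) (xMul δ h) :=
    DFunLike.congr_fun ((pow_succ' (xMul δ) i).symm.trans (pow_succ (xMul δ) i)) h
  refine h1.trans ?_
  rw [← h2, add_comm]
  rfl

theorem xMul_pow_succ_apply (k : ℕ) (h : DiffPoly δ) :
    (xMul δ ^ (k + 1)) h = xMul δ ((xMul δ ^ k) h) := by
  rw [pow_succ']
  rfl

/-- A weak form of the Leibniz formula
`X ^ k (f * h) = ∑ j ≤ k, (k choose j) • d ^ j f * X ^ (k - j) h`. -/
theorem xMul_pow_mul_mem_closure (n : ℕ) (a : ℕ → R) (h : DiffPoly δ) (k : ℕ) :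
    (xMul δ ^ k) (ofCoeffs δ n a * h) ∈ AddSubgroup.closure {u | ∃ j m, j + m = k ∧
      u = ofCoeffs δ n (fun i => δ.toFun^[j] (a i)) * (xMul δ ^ m) h} := by
  induction k with
  | zero => exact AddSubgroup.subset_closure ⟨0, 0, rfl, rfl⟩
  | succ k ih =>
    rw [xMul_pow_succ_apply]
    refine (AddSubgroup.closure_le ((AddSubgroup.closure _).comap (xMul δ))).2 ?_ ih
    rintro u ⟨j, m, hjm, rfl⟩
    change xMul δ _ ∈ AddSubgroup.closure _
    rw [xMul_ofCoeffs_mul]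
    refine add_mem (AddSubgroup.subset_closure ⟨j + 1, m, by omega, ?_⟩)
      (AddSubgroup.subset_closure ⟨j, m + 1, by omega, ?_⟩)
    · simp only [Function.iterate_succ_apply']
    · rw [xMul_pow_succ_apply]

/-- The iterated commutator `d ^ j f` of `f` with `X` lies in the right ideal generated by
`f, X f, …, X ^ j f`. -/
theorem ofCoeffs_iterate_mul_mem_closure (n : ℕ) (a : ℕ → R) (j : ℕ) (h : DiffPoly δ) :
    ofCoeffs δ n (fun i => δ.toFun^[j] (a i)) * h ∈ AddSubgroup.closure
      {u | ∃ l ≤ j, ∃ b, u = (xMul δ ^ l) (ofCoeffs δ n a) * b} := by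
  induction j generalizing h with
  | zero => exact AddSubgroup.subset_closure ⟨0, le_rfl, h, rfl⟩
  | succ j ih =>
    have key := xMul_ofCoeffs_mul δ n (fun i => δ.toFun^[j] (a i)) h
    simp only [← Function.iterate_succ_apply' δ.toFun] at key
    rw [← sub_eq_iff_eq_add] at key
    rw [← key]
    refine sub_mem ?_ (AddSubgroup.closure_mono ?_ (ih (xMul δ h)))
    · refine (AddSubgroup.closure_le ((AddSubgroup.closure _).comap (xMul δ))).2 ?_ (ih h)
      rintro u ⟨l, hl, b, rfl⟩
      change xMul δ _ ∈ AddSubgroup.closure _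
      refine AddSubgroup.subset_closure ⟨l + 1, by omega, b, ?_⟩
      rw [xMul_mul, xMul_pow_succ_apply]
    · rintro u ⟨l, hl, b, rfl⟩
      exact ⟨l, by omega, b, rfl⟩

section Descent

variable {δ} {n : ℕ} {a : ℕ → R} {J : AddSubgroup (DiffPoly δ)}

/-- Modulo `J`, the elements `X ^ k f` with `k < 2 * n` are combinations of elements
`δ ^ j (a i) (X ^ l f) b` with `l < 2 * n`. This is phrased through a right linear map `T` (left
multiplication by an element of `R`, or the identity), so that it can be iterated. -/
theorem map_xMul_pow_mem (hX : ∀ u ∈ J, xMul δ u ∈ J) (hmul : ∀ u ∈ J, ∀ b, u * b ∈ J)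
    (hf : ofCoeffs δ n a - ofCoeffs δ n a * ofCoeffs δ n a ∈ J)
    (T : AddMonoid.End (DiffPoly δ)) (hTJ : ∀ u ∈ J, T u ∈ J) (hT : ∀ u b, T (u * b) = T u * b)
    (H : ∀ j < 2 * n, ∀ i < n, ∀ l < 2 * n,
      T (coeffMul δ (δ.toFun^[j] (a i)) ((xMul δ ^ l) (ofCoeffs δ n a))) ∈ J)
    {k : ℕ} (hk : k < 2 * n) : T ((xMul δ ^ k) (ofCoeffs δ n a)) ∈ J := by
  have hXk : ∀ k, ∀ u ∈ J, (xMul δ ^ k) u ∈ J := fun k => by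
    induction k with
    | zero => exact fun u hu => hu
    | succ k ih => exact fun u hu => by rw [xMul_pow_succ_apply]; exact hX _ (ih u hu)
  have reduce : ∀ k, (∀ j m, j + m = k → T (ofCoeffs δ n (fun i => δ.toFun^[j] (a i)) *
      (xMul δ ^ m) (ofCoeffs δ n a)) ∈ J) → T ((xMul δ ^ k) (ofCoeffs δ n a)) ∈ J := by
    intro k h
    have h1 := hTJ _ (hXk k _ hf)
    rw [map_sub, map_sub] at h1
    rw [← sub_add_cancel (T ((xMul δ ^ k) (ofCoeffs δ n a)))]
    refine add_mem h1 ?_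
    refine (AddSubgroup.closure_le (J.comap T)).2 ?_
      (xMul_pow_mul_mem_closure δ n a (ofCoeffs δ n a) k)
    rintro u ⟨j, m, hjm, rfl⟩
    exact h j m hjm
  have small : ∀ j < 2 * n, ∀ m < n, T (ofCoeffs δ n (fun i => δ.toFun^[j] (a i)) *
      (xMul δ ^ m) (ofCoeffs δ n a)) ∈ J := by
    intro j hj m hm
    rw [ofCoeffs_mul, map_sum]
    refine sum_mem fun i hi => ?_
    have hi := Finset.mem_range.1 hi
    have h := H j hj i hi (i + m) (by omega)
    rw [pow_add] at h
    exact h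
  have low : ∀ k < n, T ((xMul δ ^ k) (ofCoeffs δ n a)) ∈ J := fun k hk =>
    reduce k fun j m hjm => small j (by omega) m (by omega)
  refine reduce k fun j m hjm => ?_
  rcases lt_or_ge m n with hm | hm
  · exact small j (by omega) m hm
  · refine (AddSubgroup.closure_le (J.comap T)).2 ?_
      (ofCoeffs_iterate_mul_mem_closure δ n a j ((xMul δ ^ m) (ofCoeffs δ n a)))
    rintro u ⟨l, hl, b, rfl⟩
    change T _ ∈ J
    rw [hT]
    exact hmul _ (low l (by omega)) b

/-- Descent along the nilpotency degree: left multiplication by an element `p` of `P`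
all of whose products `p * q₁ * ⋯ * q_N` with elements of `P` vanish maps all `X ^ k f` with `k < 2 * n` into `J`. -/
theorem coeffMul_xMul_pow_mem (hX : ∀ u ∈ J, xMul δ u ∈ J) (hmul : ∀ u ∈ J, ∀ b, u * b ∈ J)
    (hcoeff : ∀ r, ∀ u ∈ J, coeffMul δ r u ∈ J)
    (hf : ofCoeffs δ n a - ofCoeffs δ n a * ofCoeffs δ n a ∈ J) {P : NonUnitalSubring R}
    (hP : ∀ j < 2 * n, ∀ i < n, δ.toFun^[j] (a i) ∈ P) (N : ℕ) (p : P)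
    (hp : ∀ l : List P, l.length = N → l.foldl (fun a b => a * b) p = 0)
    {k : ℕ} (hk : k < 2 * n) : coeffMul δ (p : R) ((xMul δ ^ k) (ofCoeffs δ n a)) ∈ J := by
  induction N generalizing p k with
  | zero =>
    have h : p = 0 := hp [] rfl
    rw [h, ZeroMemClass.coe_zero, map_zero]
    exact zero_mem J
  | succ N ih =>
    refine map_xMul_pow_mem hX hmul hf (coeffMul δ (p : R)) (hcoeff _)
      (coeffMul_apply_mul δ _) (fun j hj i hi l hl => ?_) hk
    have h := ih (p * ⟨_, hP j hj i hi⟩) (fun L hL => hp (_ :: L) (by simp [hL])) hl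
    rw [MulMemClass.coe_mul, coeffMul_mul] at h
    exact h

end Descent

variable {δ}

/-- A two-sided ideal stable under left multiplication by `X` contains every element that is
idempotent modulo it. -/
theorem mem_of_sub_mul_self_mem (hR : IsLocallyNilpotentRing R) {J : AddSubgroup (DiffPoly δ)}
    (hX : ∀ u ∈ J, xMul δ u ∈ J) (hmul : ∀ u ∈ J, ∀ b, u * b ∈ J)
    (hcoeff : ∀ r, ∀ u ∈ J, coeffMul δ r u ∈ J) {f : DiffPoly δ} (hf : f - f * f ∈ J) :
    f ∈ J := by
  classical
  obtain ⟨n, a, hn, rfl⟩ := exists_eq_ofCoeffs δ f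
  let s : Finset R := (Finset.range (2 * n) ×ˢ Finset.range n).image
    fun q => δ.toFun^[q.1] (a q.2)
  have hs : ∀ j < 2 * n, ∀ i < n,
      δ.toFun^[j] (a i) ∈ NonUnitalSubring.closure (s : Set R) := fun j hj i hi =>
    NonUnitalSubring.subset_closure <| Finset.mem_coe.2 <| Finset.mem_image.2
      ⟨(j, i), Finset.mem_product.2 ⟨Finset.mem_range.2 hj, Finset.mem_range.2 hi⟩, rfl⟩
  obtain ⟨N, hN⟩ := hR s
  refine map_xMul_pow_mem hX hmul hf (AddMonoidHom.id _) (fun u hu => hu) (fun u b => rfl)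
    (fun j hj i hi l hl => ?_) (k := 0) (by omega)
  exact coeffMul_xMul_pow_mem hX hmul hcoeff hf hs N ⟨_, hs j hj i hi⟩ (hN _) hl

theorem map_eq_zero_of_isIdempotentElem (hR : IsLocallyNilpotentRing R) {A : Type*}
    [NonUnitalRing A] (φ : DiffPoly δ →ₙ+* A) {f : DiffPoly δ} (hf : IsIdempotentElem (φ f)) :
    φ f = 0 := by
  -- The kernel of `φ` need not be stable under left multiplication by `X`, unlike this ideal.
  let J : AddSubgroup (DiffPoly δ) :=
    { carrier := {s | ∀ t, φ (t * s) = 0}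
      zero_mem' := fun t => by rw [mul_zero, map_zero]
      add_mem' := fun {u v} hu hv t => by rw [mul_add, map_add, hu t, hv t, add_zero]
      neg_mem' := fun {u} hu t => by rw [mul_neg, map_neg, hu t, neg_zero] }
  have h : f ∈ J := by
    refine mem_of_sub_mul_self_mem hR (J := J) (fun u hu t => ?_) (fun u hu b t => ?_)
      (fun r u hu t => ?_) (fun t => ?_)
    · obtain ⟨t', ht'⟩ := exists_mul_xMul δ t
      rw [ht', hu]
    · rw [← mul_assoc, map_mul, hu, zero_mul]
    · have h : monomial δ 0 r * u = coeffMul δ r u := monomial_mul δ 0 r u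
      rw [← h, ← mul_assoc, hu]
    · rw [map_mul, map_sub, map_mul, hf.eq, sub_self, mul_zero]
  rw [← hf.eq, ← map_mul]
  exact h f

end DiffPoly

theorem theorem1 {R : Type*} [NonUnitalRing R] (hR : IsLocallyNilpotentRing R)
    (δ : RingDerivation R) :
    (¬ ∃ (A : Type*) (_ : NonUnitalRing A) (φ : DiffPoly δ →ₙ+* A),
      Function.Surjective φ ∧ ∃ e : A, IsIdempotentElem e ∧ e ≠ 0) ∧
    IsBehrensRadical (DiffPoly δ) := by
  constructor
  · rintro ⟨A, _, φ, hφ, e, he, hne⟩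
    obtain ⟨f, rfl⟩ := hφ e
    exact hne (DiffPoly.map_eq_zero_of_isIdempotentElem hR φ he)
  · rintro ⟨A, _, φ, hφ, -, e, -, he, hne⟩
    obtain ⟨f, rfl⟩ := hφ e
    exact hne (DiffPoly.map_eq_zero_of_isIdempotentElem hR φ he)
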